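/- Let $1\le p<\infty$ and let $(\Omega,\mathcal F,\mathbb P)$ be a probability space. (a) Let $\{\xi_{j,m}:\ j\in\mathbb N_0,\ 0\le m\le 2^j-1\}$ be independent standard Gaussian random variables on $\Omega$. Then, almost surely, $$\sup_{j\in\mathbb N_0} 2^{-j}\sum_{m=0}^{2^j-1}|\xi_{j,m}|^p<\infty .$$ (b) Let $W=(W_t)_{t\ge 0}$ be a Brownian motion (Wiener process) on $\Omega$, and let $$\xi_{j,m}=-2^{j/2}\,\bigl(W_{(m+1)2^{-j}}-2W_{(2m+1)2^{-j-1}}+W_{m2^{-j}}\bigr),\qquad j\in\mathbb N_0,\ 0\le m\le 2^j-1,$$ be the coefficients in its expansion $W_t=W_1\,t+\sum_{j\ge 0}\sum_{m=0}^{2^j-1}2^{-(j+2)/2}\xi_{j,m}v_{j,m}(t)$ on $[0,1]$ into the Faber system, where $v_{j,m}$ is the hat function supported in $[m2^{-j},(m+1)2^{-j}]$ with height $1$. Then, almost surely, $$\sup_{j\in\mathbb N_0} 2^{-j}\sum_{m=0}^{2^j-1}|\xi_{j,m}|^p<\infty ,$$ and, almost surely, the path $t\mapsto W_t$, $t\in[0,1]$,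 belongs to the Besov space $B^{1/2}_{p,\infty}([0,1])$. Here, for $s>0$ and $0<p,q\le\infty$, the Besov space $B^s_{p,q}(\mathbb R)$ is the set of all $g\in L_p(\mathbb R)$ such that, with $M=\lfloor s\rfloor+1$, $(\Delta^1_hg)(x)=g(x+h)-g(x)$ and $\Delta_h^{k+1}g=\Delta_h^1(\Delta_h^kg)$, $$\|g\|_{L_p(\mathbb R)}+\Bigl(\int_0^1t^{-sq}\sup_{|h|\le t}\|\Delta_h^Mg\|_{L_p(\mathbb R)}^q\,\frac{dt}{t}\Bigr)^{1/q}<\infty ,$$ where for $q=\infty$ the second term is replaced by $\sup_{0<t\le1}t^{-s}\sup_{|h|\le t}\|\Delta_h^Mg\|_{L_p(\mathbb R)}$, and $B^s_{p,q}([0,1])$ is the set of all $f\in L_p([0,1])$ which agree (almost everywhere) on $[0,1]$ with some $g\in B^s_{p,q}(\mathbb R)$. -/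

import Mathlib

open MeasureTheory ProbabilityTheory Set
open scoped ENNReal NNReal

namespace Besov

/-- The `M`-th order modulus of smoothness `sup_{|h| ≤ t} ‖Δ_h^M f‖_{L_p(ℝ)}`, where
`Δ_h^1 f (x) = f (x + h) - f x` and `Δ_h^{M+1} f = Δ_h^1 (Δ_h^M f)`. -/
noncomputable def modulus {E : Type*} [NormedAddCommGroup E]
    (M : ℕ) (p : ℝ≥0∞) (f : ℝ → E) (t : ℝ) : ℝ≥0∞ :=
  ⨆ (h : ℝ) (_ : |h| ≤ t), eLpNorm ((fwdDiff h)^[M] f) p volume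

/-- The Besov seminorm
`(∫_0^1 t^{-sq} sup_{|h| ≤ t} ‖Δ_h^M f‖_p^q dt/t)^{1/q}` with `M = ⌊s⌋ + 1`, with the usual
modification `sup_{0 < t ≤ 1} t^{-s} sup_{|h| ≤ t} ‖Δ_h^M f‖_p` for `q = ∞`.
Meant for `s > 0` and `0 < p, q ≤ ∞`. -/
noncomputable def eSeminorm {E : Type*} [NormedAddCommGroup E]
    (s : ℝ) (p q : ℝ≥0∞) (f : ℝ → E) : ℝ≥0∞ :=
  open Classical in
  if q = ∞ then
    ⨆ (t : ℝ) (_ : t ∈ Ioc (0 : ℝ) 1), ENNReal.ofReal (t ^ (-s)) * modulus (⌊s⌋₊ + 1) p f t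
  else
    (∫⁻ t in Ioc (0 : ℝ) 1,
      ENNReal.ofReal (t ^ (-(s * q.toReal))) * modulus (⌊s⌋₊ + 1) p f t ^ q.toReal
        * ENNReal.ofReal (1 / t)) ^ (1 / q.toReal)

/-- The Besov (quasi-)norm on `ℝ`. -/
noncomputable def eNorm {E : Type*} [NormedAddCommGroup E]
    (s : ℝ) (p q : ℝ≥0∞) (f : ℝ → E) : ℝ≥0∞ :=
  eLpNorm f p volume + eSeminorm s p q f

/-- (Representatives of elements of) the Besov space `B^s_{p,q}(ℝ)`. -/
def spaceReal (E : Type*) [NormedAddCommGroup E] (s : ℝ) (p q : ℝ≥0∞) : Set (ℝ → E) :=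
  {f | MemLp f p volume ∧ eNorm s p q f < ∞}

/-- (Representatives of elements of) the Besov space `B^s_{p,q}([0,1])`, defined by restriction:
all `f ∈ L_p([0,1])` that agree a.e. on `[0,1]` with some `g ∈ B^s_{p,q}(ℝ)`.
The values of `f` outside `[0,1]` are irrelevant. -/
def spaceUnitInterval (E : Type*) [NormedAddCommGroup E] (s : ℝ) (p q : ℝ≥0∞) : Set (ℝ → E) :=
  {f | MemLp f p (volume.restrict (Icc (0 : ℝ) 1)) ∧
    ∃ g ∈ spaceReal E s p q, g =ᵐ[volume.restrict (Icc (0 : ℝ) 1)] f}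

end Besov

/-- The sample path `t ↦ W_t(ω)`, as a function on `ℝ` (only its values for `t ≥ 0` matter). -/
def samplePath {Ω : Type*} (W : ℝ≥0 → Ω → ℝ) (ω : Ω) : ℝ → ℝ :=
  fun t => W t.toNNReal ω

/-- The normalized Faber coefficient `-2^{j/2} (Δ^2_{2^{-j-1}} f)(2^{-j} m)`, i.e. the number
`λ_{j,m}` in the Faber expansion `∑_{j,m} 2^{-(j+2)/2} λ_{j,m} v_{j,m}` of `f`. -/
noncomputable def faberCoeff (f : ℝ → ℝ) (j m : ℕ) : ℝ :=
  -(2 : ℝ) ^ ((j : ℝ) / 2) * (fwdDiff ((2 : ℝ)⁻¹ ^ (j + 1)))^[2] f ((m : ℝ) * (2 : ℝ)⁻¹ ^ j)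

/-! The averages of level `j` have a common mean and, by pairwise independence within the level,
variance `2⁻ʲ V`. The squared deviations therefore have summable expectations, so almost surely
their sum is finite and the averages are bounded.

For Brownian motion everything rests on the increments over dyadic intervals: scaled by `2^{j/2}`,
those of level `j` are independent standard Gaussians, so their `p`-averages are bounded too. A
Faber coefficient is a difference of two neighbouring increments of the next level and inherits the
bound.

Besov regularity follows by chaining, without summing the Faber series. The bound says that the step
function of level-`n` increments has `L_p` norm `O(2^{-n/2})`. Telescoping over levels puts `f`
within `O(2^{-n/2})` of its dyadic discretization, and a shift by `|h| ≤ 2⁻ⁿ` moves that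
discretization by at most one step, so `‖Δ_h f‖_p = O(2^{-n/2})`. Reflection about `1` gives a
compactly supported extension. -/

theorem memLp_abs_rpow_of_hasLaw_gaussianReal {Ω : Type*} [MeasurableSpace Ω] {P : Measure Ω}
    {X : Ω → ℝ} {μ : ℝ} {v : ℝ≥0} (hX : HasLaw X (gaussianReal μ v) P) {p : ℝ} (hp : 0 < p) :
    MemLp (fun ω => |X ω| ^ p) 2 P := by
  have h1 : MemLp (fun x : ℝ => |x| ^ p) 2 (gaussianReal μ v) := by
    have h := (memLp_id_gaussianReal' (μ := μ) (v := v) (ENNReal.ofReal p * 2)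
      (by finiteness)).norm_rpow_div (ENNReal.ofReal p)
    rw [ENNReal.toReal_ofReal hp.le, mul_comm,
      ENNReal.mul_div_cancel_right (by simpa using hp) (by simp)] at h
    simpa using h
  rw [← hX.map_eq] at h1
  exact h1.comp_of_map hX.aemeasurable

/-- The averages of `|η j m| ^ p` over the `2 ^ j` standard Gaussian variables of level `j` are
almost surely bounded in `j`, if the variables of each level are pairwise independent. -/
theorem ae_bddAbove_average_abs_rpow {Ω : Type*} [MeasurableSpace Ω] (P : Measure Ω)
    [IsProbabilityMeasure P] {p : ℝ} (hp : 0 < p) (η : (j : ℕ) → Fin (2 ^ j) → Ω → ℝ)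
    (hlaw : ∀ j m, HasLaw (η j m) (gaussianReal 0 1) P)
    (hind : ∀ j, Pairwise fun m m' => IndepFun (η j m) (η j m') P) :
    ∀ᵐ ω ∂P, BddAbove (range fun j : ℕ => (2 : ℝ)⁻¹ ^ j * ∑ m : Fin (2 ^ j), |η j m ω| ^ p) := by
  set μ : ℝ := ∫ x, |x| ^ p ∂gaussianReal 0 1
  set V : ℝ := Var[fun x => |x| ^ p; gaussianReal 0 1]
  have hmeas : Measurable fun x : ℝ => |x| ^ p := by fun_prop
  have hL (j m) : MemLp (fun ω => |η j m ω| ^ p) 2 P :=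
    memLp_abs_rpow_of_hasLaw_gaussianReal (hlaw j m) hp
  set X : ℕ → Ω → ℝ := fun j ω => (2 : ℝ)⁻¹ ^ j * ∑ m : Fin (2 ^ j), |η j m ω| ^ p with hX
  have hXL (j) : MemLp (X j) 2 P := (memLp_finsetSum _ fun m _ => hL j m).const_mul _
  have hmean (j) : P[X j] = μ := by
    rw [hX, integral_const_mul, integral_finsetSum _ fun m _ => (hL j m).integrable (by simp)]
    have (m : Fin (2 ^ j)) : ∫ ω, |η j m ω| ^ p ∂P = μ :=
      (hlaw j m).integral_comp hmeas.aestronglyMeasurable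
    simp [this]
  have hvar (j) : Var[X j; P] = (2 : ℝ)⁻¹ ^ j * V := by
    have h1 : Var[∑ m : Fin (2 ^ j), fun ω => |η j m ω| ^ p; P]
        = ∑ m : Fin (2 ^ j), Var[fun ω => |η j m ω| ^ p; P] :=
      IndepFun.variance_sum (fun m _ => hL j m) fun m _ m' _ hm =>
        (hind j hm).comp hmeas hmeas
    have h2 (m : Fin (2 ^ j)) : Var[fun ω => |η j m ω| ^ p; P] = V := by
      have := (HasLaw.mk (μ := (gaussianReal 0 1).map fun x : ℝ => |x| ^ p)
        hmeas.aemeasurable rfl).comp (hlaw j m) |>.variance_eq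
      rw [variance_map aemeasurable_id hmeas.aemeasurable] at this
      exact this
    have h3 : X j = fun ω => (2 : ℝ)⁻¹ ^ j * (∑ m : Fin (2 ^ j), fun ω => |η j m ω| ^ p) ω := by
      ext ω; simp [hX]
    rw [h3, variance_const_mul, h1]
    simp only [h2, Finset.sum_const, Finset.card_univ, Fintype.card_fin, nsmul_eq_mul]
    push_cast
    rw [sq, mul_assoc, ← mul_assoc _ (2 ^ j : ℝ) V, ← mul_pow]
    norm_num
  -- By Tonelli this is the geometric series of the variances.
  have hfin : ∫⁻ ω, ∑' j, ENNReal.ofReal ((X j ω - μ) ^ 2) ∂P ≠ ∞ := by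
    rw [lintegral_tsum fun j => (((hXL j).aemeasurable.sub_const μ).pow_const 2).ennreal_ofReal]
    have hj (j) : ∫⁻ ω, ENNReal.ofReal ((X j ω - μ) ^ 2) ∂P = ENNReal.ofReal ((2 : ℝ)⁻¹ ^ j * V) := by
      rw [← hvar, ofReal_variance (hXL j), evariance_eq_lintegral_ofReal, hmean]
    simp only [hj]
    refine Summable.tsum_ofReal_ne_top ((summable_geometric_of_lt_one ?_ ?_).mul_right V) <;>
      norm_num
  filter_upwards [ae_lt_top' (AEMeasurable.tsum fun j =>
    (((hXL j).aemeasurable.sub_const μ).pow_const 2).ennreal_ofReal) hfin] with ω hω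
  set S := ∑' j, ENNReal.ofReal ((X j ω - μ) ^ 2)
  refine ⟨μ + (1 + S.toReal), ?_⟩
  rintro _ ⟨j, rfl⟩
  have h1 : (X j ω - μ) ^ 2 ≤ S.toReal :=
    (ENNReal.ofReal_le_iff_le_toReal hω.ne).1 (ENNReal.le_tsum j)
  change X j ω ≤ _
  -- Uses `y ≤ 1 + y²` for the deviation `y = X j ω - μ`.
  nlinarith [sq_nonneg (X j ω - μ - 1)]

/-! ### Dyadic increments of Brownian motion and Faber coefficients -/

/-- The increment of `f` over the dyadic interval `[k 2^{-n}, (k + 1) 2^{-n}]`. -/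
noncomputable def dyadicIncr (f : ℝ → ℝ) (n k : ℕ) : ℝ :=
  f ((k + 1 : ℝ) * (2 : ℝ)⁻¹ ^ n) - f ((k : ℝ) * (2 : ℝ)⁻¹ ^ n)

theorem ae_bddAbove_average_dyadicIncr {Ω : Type*} [MeasurableSpace Ω] (P : Measure Ω)
    [IsProbabilityMeasure P] {p : ℝ} (hp : 0 < p) {W : ℝ≥0 → Ω → ℝ} (hW : IsPreBrownianReal W P) :
    ∀ᵐ ω ∂P, BddAbove (range fun j : ℕ => (2 : ℝ)⁻¹ ^ j *
      ∑ m : Fin (2 ^ j), |(2 : ℝ) ^ ((j : ℝ) / 2) * dyadicIncr (samplePath W ω) j m| ^ p) := by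
  have key (j k : ℕ) (ω : Ω) : dyadicIncr (samplePath W ω) j k =
      W ((k + 1 : ℕ) * (2 : ℝ≥0)⁻¹ ^ j) ω - W (k * (2 : ℝ≥0)⁻¹ ^ j) ω := by
    have h1 (k : ℕ) : ((k : ℝ) * (2 : ℝ)⁻¹ ^ j).toNNReal = k * (2 : ℝ≥0)⁻¹ ^ j := by
      rw [← Real.toNNReal_coe (r := k * (2 : ℝ≥0)⁻¹ ^ j)]; simp
    have h2 := h1 (k + 1)
    push_cast at h2
    simp only [dyadicIncr, samplePath, h1, h2, Nat.cast_add, Nat.cast_one]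
  refine ae_bddAbove_average_abs_rpow P hp (fun j m ω => (2 : ℝ) ^ ((j : ℝ) / 2) *
    dyadicIncr (samplePath W ω) j m) (fun j m => ?_) fun j m m' hm => ?_
  · simp only [key]
    have h := gaussianReal_const_mul (hW.hasLaw_sub ((m + 1 : ℕ) * (2 : ℝ≥0)⁻¹ ^ j)
      (m * (2 : ℝ≥0)⁻¹ ^ j)) ((2 : ℝ) ^ ((j : ℝ) / 2))
    -- The increment has variance `2⁻ʲ`, which the squared factor `2^{j/2}` normalizes to `1`.
    have hv : 1 = NNReal.mk (((2 : ℝ) ^ ((j : ℝ) / 2)) ^ 2) (sq_nonneg _) *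
        nndist (((m + 1 : ℕ) * (2 : ℝ≥0)⁻¹ ^ j : ℝ≥0) : ℝ) ((m * (2 : ℝ≥0)⁻¹ ^ j : ℝ≥0) : ℝ) := by
      apply NNReal.eq
      simp only [NNReal.coe_mul, NNReal.coe_one, NNReal.coe_mk, coe_nndist, Real.dist_eq]
      rw [← Real.rpow_natCast, ← Real.rpow_mul (by norm_num)]
      push_cast
      rw [← sub_mul, add_sub_cancel_left, one_mul, abs_of_pos (by positivity),
        div_mul_cancel₀ _ (by norm_num), Real.rpow_natCast, ← mul_pow]
      norm_num
    rw [← show (2 : ℝ) ^ ((j : ℝ) / 2) * 0 = 0 by simp, hv]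
    exact h
  · simp only [key]
    have hmono : Monotone fun k : ℕ => (k : ℝ≥0) * (2 : ℝ≥0)⁻¹ ^ j := fun a b hab => by
      dsimp only
      gcongr
    have h := (hW.hasIndepIncrements.nat hmono).indepFun (fun h => hm (Fin.ext h))
    exact h.comp (φ := fun x => (2 : ℝ) ^ ((j : ℝ) / 2) * x)
      (ψ := fun x => (2 : ℝ) ^ ((j : ℝ) / 2) * x) (by fun_prop) (by fun_prop)

theorem abs_sub_rpow_le {p : ℝ} (hp : 1 ≤ p) (a b : ℝ) :
    |a - b| ^ p ≤ 2 ^ (p - 1) * (|a| ^ p + |b| ^ p) := by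
  have h := NNReal.rpow_add_le_mul_rpow_add_rpow ‖a‖₊ ‖b‖₊ hp
  have h' : (|a| + |b|) ^ p ≤ 2 ^ (p - 1) * (|a| ^ p + |b| ^ p) := by exact_mod_cast h
  exact (Real.rpow_le_rpow (abs_nonneg _) (abs_sub a b) (by linarith)).trans h'

theorem sum_range_two_mul {M : Type*} [AddCommMonoid M] (F : ℕ → M) (n : ℕ) :
    ∑ k ∈ Finset.range (2 * n), F k = ∑ m ∈ Finset.range n, (F (2 * m) + F (2 * m + 1)) := by
  induction n with
  | zero => simp
  | succ n ih => rw [mul_add, mul_one, Finset.sum_range_succ, Finset.sum_range_succ, ih,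
      Finset.sum_range_succ, add_assoc]

/-- Makes the independence and the law of the Faber coefficients themselves unnecessary: bounds for
increments suffice. -/
theorem faberCoeff_eq_dyadicIncr (f : ℝ → ℝ) (j m : ℕ) :
    faberCoeff f j m = (2 : ℝ) ^ ((j : ℝ) / 2) * dyadicIncr f (j + 1) (2 * m)
      - (2 : ℝ) ^ ((j : ℝ) / 2) * dyadicIncr f (j + 1) (2 * m + 1) := by
  have h0 : (m : ℝ) * (2 : ℝ)⁻¹ ^ j = 2 * m * (2 : ℝ)⁻¹ ^ (j + 1) := by ring
  simp only [faberCoeff, dyadicIncr, Function.iterate_succ, Function.iterate_zero,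
    Function.comp_apply, id, fwdDiff, h0]
  push_cast
  ring_nf

/-- The `p`-averages of the Faber coefficients are controlled by those of the increments. -/
theorem bddAbove_average_faberCoeff {p : ℝ} (hp : 1 ≤ p) (f : ℝ → ℝ)
    (hf : BddAbove (range fun j : ℕ => (2 : ℝ)⁻¹ ^ j *
      ∑ m : Fin (2 ^ j), |(2 : ℝ) ^ ((j : ℝ) / 2) * dyadicIncr f j m| ^ p)) :
    BddAbove (range fun j : ℕ =>
      (2 : ℝ)⁻¹ ^ j * ∑ m : Fin (2 ^ j), |faberCoeff f j m| ^ p) := by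
  obtain ⟨C, hC⟩ := hf
  refine ⟨2 ^ p * C, ?_⟩
  rintro _ ⟨j, rfl⟩
  have h1 : (2 : ℝ)⁻¹ ^ (j + 1) *
      ∑ m : Fin (2 ^ (j + 1)), |(2 : ℝ) ^ (((j + 1 : ℕ) : ℝ) / 2) * dyadicIncr f (j + 1) m| ^ p ≤ C :=
    hC ⟨j + 1, rfl⟩
  rw [Fin.sum_univ_eq_sum_range
    (fun m => |(2 : ℝ) ^ (((j + 1 : ℕ) : ℝ) / 2) * dyadicIncr f (j + 1) m| ^ p)] at h1
  dsimp only
  rw [Fin.sum_univ_eq_sum_range (fun m => |faberCoeff f j m| ^ p)]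
  have hle (k : ℕ) : |(2 : ℝ) ^ ((j : ℝ) / 2) * dyadicIncr f (j + 1) k| ^ p ≤
      |(2 : ℝ) ^ (((j + 1 : ℕ) : ℝ) / 2) * dyadicIncr f (j + 1) k| ^ p := by
    simp only [abs_mul]
    gcongr
    · norm_num
    · simp
  -- The constant `2 ^ p` is `2 ^ (p - 1)` from convexity times `2` from passing to level `j + 1`.
  calc (2 : ℝ)⁻¹ ^ j * ∑ m ∈ Finset.range (2 ^ j), |faberCoeff f j m| ^ p
      ≤ (2 : ℝ)⁻¹ ^ j * ∑ m ∈ Finset.range (2 ^ j), 2 ^ (p - 1) *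
        (|(2 : ℝ) ^ (((j + 1 : ℕ) : ℝ) / 2) * dyadicIncr f (j + 1) (2 * m)| ^ p +
          |(2 : ℝ) ^ (((j + 1 : ℕ) : ℝ) / 2) * dyadicIncr f (j + 1) (2 * m + 1)| ^ p) := by
        gcongr with m
        rw [faberCoeff_eq_dyadicIncr]
        refine (abs_sub_rpow_le hp _ _).trans ?_
        gcongr 2 ^ (p - 1) * (?_ + ?_)
        · exact hle _
        · exact hle _
    _ = 2 ^ p * ((2 : ℝ)⁻¹ ^ (j + 1) * ∑ m ∈ Finset.range (2 ^ (j + 1)),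
          |(2 : ℝ) ^ (((j + 1 : ℕ) : ℝ) / 2) * dyadicIncr f (j + 1) m| ^ p) := by
        rw [pow_succ' 2 j, sum_range_two_mul, ← Finset.mul_sum, Real.rpow_sub_one (by norm_num)]
        ring
    _ ≤ _ := by gcongr

/-! ### Dyadic discretization -/

/-- The largest multiple of `2^{-n}` which is at most `x`. -/
noncomputable def dyadicFloor (n : ℕ) (x : ℝ) : ℝ := (⌊x * 2 ^ n⌋ : ℝ) * (2 : ℝ)⁻¹ ^ n

/-- The increment of `f` over the dyadic interval of length `2^{-n}` which contains `x`. -/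
noncomputable def dyadicStep (f : ℝ → ℝ) (n : ℕ) (x : ℝ) : ℝ :=
  f (dyadicFloor n x + (2 : ℝ)⁻¹ ^ n) - f (dyadicFloor n x)

theorem measurable_dyadicFloor (n : ℕ) : Measurable (dyadicFloor n) := by
  unfold dyadicFloor
  have : Measurable fun x : ℝ => ⌊x * 2 ^ n⌋ := Int.measurable_floor.comp (by fun_prop)
  exact (measurable_from_top.comp this : Measurable fun x : ℝ => (⌊x * 2 ^ n⌋ : ℝ)).mul_const _

theorem measurable_dyadicStep {f : ℝ → ℝ} (hf : Continuous f) (n : ℕ) :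
    Measurable (dyadicStep f n) :=
  (hf.measurable.comp ((measurable_dyadicFloor n).add_const _)).sub
    (hf.measurable.comp (measurable_dyadicFloor n))

theorem abs_sub_dyadicFloor_le (n : ℕ) (x : ℝ) : |dyadicFloor n x - x| ≤ (2 : ℝ)⁻¹ ^ n := by
  have h2 : (0 : ℝ) < 2 ^ n := by positivity
  have h1 : dyadicFloor n x - x = (⌊x * 2 ^ n⌋ - x * 2 ^ n) * (2 : ℝ)⁻¹ ^ n := by
    rw [dyadicFloor, sub_mul, mul_assoc, ← mul_pow]; norm_num
  rw [h1, abs_mul, abs_of_pos (by positivity : (0 : ℝ) < (2 : ℝ)⁻¹ ^ n)]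
  refine mul_le_of_le_one_left (by positivity) (abs_le.2 ?_)
  constructor <;> linarith [Int.floor_le (x * 2 ^ n), Int.lt_floor_add_one (x * 2 ^ n)]

theorem tendsto_dyadicFloor (x : ℝ) :
    Filter.Tendsto (fun n => dyadicFloor n x) Filter.atTop (nhds x) := by
  rw [tendsto_iff_dist_tendsto_zero]
  exact squeeze_zero (fun _ => dist_nonneg) (fun n => abs_sub_dyadicFloor_le n x)
    (tendsto_pow_atTop_nhds_zero_of_lt_one (by norm_num) (by norm_num))

/-- Refining the grid leaves the floor fixed or moves it one fine step to the right. In the second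
case the change is the increment over the fine interval just left of the one containing `x`; the
resulting translation is harmless for `L_p(ℝ)` norms. -/
theorem abs_comp_dyadicFloor_succ_sub_le (f : ℝ → ℝ) (n : ℕ) (x : ℝ) :
    |f (dyadicFloor (n + 1) x) - f (dyadicFloor n x)| ≤
      |dyadicStep f (n + 1) (x - (2 : ℝ)⁻¹ ^ (n + 1))| := by
  have hx : (x - (2 : ℝ)⁻¹ ^ (n + 1)) * 2 ^ (n + 1) = x * 2 ^ (n + 1) - 1 := by
    rw [sub_mul, ← mul_pow]; norm_num
  have h1 : dyadicFloor (n + 1) (x - (2 : ℝ)⁻¹ ^ (n + 1)) =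
      dyadicFloor (n + 1) x - (2 : ℝ)⁻¹ ^ (n + 1) := by
    simp only [dyadicFloor, hx, Int.floor_sub_one]; push_cast; ring
  have hb : ⌊x * 2 ^ (n + 1)⌋ = 2 * ⌊x * 2 ^ n⌋ ∨ ⌊x * 2 ^ (n + 1)⌋ = 2 * ⌊x * 2 ^ n⌋ + 1 := by
    have h2 := Int.floor_le (x * 2 ^ n)
    have h3 := Int.lt_floor_add_one (x * 2 ^ n)
    have h4 : x * 2 ^ (n + 1) = 2 * (x * 2 ^ n) := by ring
    have h5 : 2 * ⌊x * 2 ^ n⌋ ≤ ⌊x * 2 ^ (n + 1)⌋ := by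
      rw [Int.le_floor, h4]; push_cast; linarith
    have h6 : ⌊x * 2 ^ (n + 1)⌋ < 2 * ⌊x * 2 ^ n⌋ + 2 := by
      rw [Int.floor_lt, h4]; push_cast; linarith
    omega
  rw [dyadicStep, h1, sub_add_cancel]
  rcases hb with hb | hb
  · have : dyadicFloor (n + 1) x = dyadicFloor n x := by
      simp only [dyadicFloor, hb]; push_cast; ring
    simp [this]
  · have : dyadicFloor (n + 1) x - (2 : ℝ)⁻¹ ^ (n + 1) = dyadicFloor n x := by
      simp only [dyadicFloor, hb]; push_cast; ring
    rw [this]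

/-- The points `x` and `x + h` lie in the same or in adjacent dyadic intervals. -/
theorem abs_comp_dyadicFloor_add_sub_le (f : ℝ → ℝ) {n : ℕ} {h : ℝ} (h0 : 0 ≤ h)
    (hn : h ≤ (2 : ℝ)⁻¹ ^ n) (x : ℝ) :
    |f (dyadicFloor n (x + h)) - f (dyadicFloor n x)| ≤ |dyadicStep f n x| := by
  have h1 : h * 2 ^ n ≤ 1 := by
    calc h * 2 ^ n ≤ (2 : ℝ)⁻¹ ^ n * 2 ^ n := by gcongr
      _ = 1 := by rw [← mul_pow]; norm_num
  have h2 : 0 ≤ h * 2 ^ n := by positivity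
  have hb : ⌊(x + h) * 2 ^ n⌋ = ⌊x * 2 ^ n⌋ ∨ ⌊(x + h) * 2 ^ n⌋ = ⌊x * 2 ^ n⌋ + 1 := by
    have h3 := Int.floor_le (x * 2 ^ n)
    have h4 := Int.lt_floor_add_one (x * 2 ^ n)
    have h5 : ⌊x * 2 ^ n⌋ ≤ ⌊(x + h) * 2 ^ n⌋ := by
      rw [Int.le_floor, add_mul]; linarith
    have h6 : ⌊(x + h) * 2 ^ n⌋ < ⌊x * 2 ^ n⌋ + 2 := by
      rw [Int.floor_lt, add_mul]; push_cast; linarith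
    omega
  rcases hb with hb | hb
  · simp [dyadicFloor, hb]
  · have : dyadicFloor n (x + h) = dyadicFloor n x + (2 : ℝ)⁻¹ ^ n := by
      simp only [dyadicFloor, hb]; push_cast; ring
    rw [this, dyadicStep]

/-! ### `L_p` norms of the step functions of increments -/

section UnitInterval

variable {f : ℝ → ℝ}

/-- The integrand is constant on each dyadic interval of length `2⁻ⁿ` and vanishes outside `[0, 1)`,
since `f` is constant on either side. -/
theorem lintegral_dyadicStep_le (h0 : ∀ x ≤ 0, f x = f 0) (h1 : ∀ x, 1 ≤ x → f x = f 1) {p : ℝ}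
    (hp : 0 < p) (n : ℕ) :
    ∫⁻ x, ‖dyadicStep f n x‖ₑ ^ p ≤
      ENNReal.ofReal ((2 : ℝ)⁻¹ ^ n * ∑ m : Fin (2 ^ n), |dyadicIncr f n m| ^ p) := by
  have hpos : (0 : ℝ) < 2 ^ n := by positivity
  have hinv : (2 : ℝ) ^ n * (2 : ℝ)⁻¹ ^ n = 1 := by rw [← mul_pow]; norm_num
  have hipos : (0 : ℝ) < (2 : ℝ)⁻¹ ^ n := by positivity
  have hpt (x : ℝ) : ‖dyadicStep f n x‖ₑ ^ p ≤ ∑ m : Fin (2 ^ n),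
      (Ico ((m : ℝ) * (2 : ℝ)⁻¹ ^ n) ((m + 1 : ℝ) * (2 : ℝ)⁻¹ ^ n)).indicator
        (fun _ => ‖dyadicIncr f n m‖ₑ ^ p) x := by
    rcases lt_or_ge ⌊x * 2 ^ n⌋ 0 with hlt | hge
    · have h2 : (⌊x * 2 ^ n⌋ : ℝ) ≤ -1 := by exact_mod_cast Int.le_sub_one_of_lt hlt
      have : dyadicStep f n x = 0 := by
        rw [dyadicStep, dyadicFloor, h0 _ (by nlinarith), h0 (_ * _) (by nlinarith), sub_self]
      simp [this, hp]
    rcases lt_or_ge ⌊x * 2 ^ n⌋ (2 ^ n) with hlt | hge'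
    · obtain ⟨k, hk⟩ := Int.eq_ofNat_of_zero_le hge
      have hk' : k < 2 ^ n := by rw [hk] at hlt; exact_mod_cast hlt
      refine le_trans ?_ (Finset.single_le_sum (fun _ _ => zero_le) (Finset.mem_univ ⟨k, hk'⟩))
      obtain ⟨ha, hb⟩ := Int.floor_eq_iff.1 hk
      rw [indicator_of_mem]
      · rw [dyadicStep, dyadicFloor, hk, dyadicIncr]
        push_cast
        rw [add_mul, one_mul]
      · push_cast at ha hb
        have hxe : x = x * 2 ^ n * (2 : ℝ)⁻¹ ^ n := by rw [mul_assoc, hinv, mul_one]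
        rw [hxe]
        exact ⟨by gcongr, by gcongr⟩
    · have h2 : (2 : ℝ) ^ n ≤ (⌊x * 2 ^ n⌋ : ℝ) := by exact_mod_cast hge'
      have : dyadicStep f n x = 0 := by
        rw [dyadicStep, dyadicFloor, h1 _ (by nlinarith), h1 (_ * _) (by nlinarith), sub_self]
      simp [this, hp]
  refine (lintegral_mono hpt).trans ?_
  rw [lintegral_finsetSum _ fun m _ => measurable_const.indicator measurableSet_Ico,
    ENNReal.ofReal_mul hipos.le, ENNReal.ofReal_sum_of_nonneg fun _ _ => by positivity,
    Finset.mul_sum]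
  refine Finset.sum_le_sum fun m _ => ?_
  rw [lintegral_indicator_const measurableSet_Ico, Real.volume_Ico, ← sub_mul, add_sub_cancel_left,
    one_mul, mul_comm, Real.enorm_eq_ofReal_abs, ENNReal.ofReal_rpow_of_nonneg (abs_nonneg _) hp.le]

theorem eLpNorm_dyadicStep_le (h0 : ∀ x ≤ 0, f x = f 0) (h1 : ∀ x, 1 ≤ x → f x = f 1) {p : ℝ}
    (hp : 0 < p) {C : ℝ} {n : ℕ} (hC : (2 : ℝ)⁻¹ ^ n *
      ∑ m : Fin (2 ^ n), |(2 : ℝ) ^ ((n : ℝ) / 2) * dyadicIncr f n m| ^ p ≤ C) :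
    eLpNorm (dyadicStep f n) (ENNReal.ofReal p) volume ≤
      ENNReal.ofReal (C ^ (1 / p) * (√2)⁻¹ ^ n) := by
  have hs : (2 : ℝ) ^ ((n : ℝ) / 2) = √2 ^ n := by
    rw [Real.sqrt_eq_rpow, ← Real.rpow_natCast, ← Real.rpow_mul (by norm_num)]
    congr 1; ring
  have hs0 : (0 : ℝ) < √2 ^ n := by positivity
  have hC0 : 0 ≤ C := le_trans (by positivity) hC
  simp only [hs, abs_mul, abs_of_pos hs0] at hC
  simp only [Real.mul_rpow hs0.le (abs_nonneg _), ← Finset.mul_sum] at hC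
  rw [eLpNorm_eq_lintegral_rpow_enorm_toReal (by simpa using hp) (by simp),
    ENNReal.toReal_ofReal hp.le]
  have h2 : (2 : ℝ)⁻¹ ^ n * ∑ m : Fin (2 ^ n), |dyadicIncr f n m| ^ p ≤
      (C ^ (1 / p) * (√2)⁻¹ ^ n) ^ p := by
    rw [Real.mul_rpow (by positivity) (by positivity), ← Real.rpow_mul hC0,
      one_div_mul_cancel hp.ne', Real.rpow_one, inv_pow (√2), Real.inv_rpow hs0.le,
      ← div_eq_mul_inv, le_div_iff₀ (by positivity)]
    linarith
  calc (∫⁻ x, ‖dyadicStep f n x‖ₑ ^ p) ^ (1 / p)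
      ≤ (ENNReal.ofReal ((C ^ (1 / p) * (√2)⁻¹ ^ n) ^ p)) ^ (1 / p) := by
        gcongr
        exact (lintegral_dyadicStep_le h0 h1 hp n).trans (ENNReal.ofReal_le_ofReal h2)
    _ = _ := by
        rw [← ENNReal.ofReal_rpow_of_nonneg (by positivity) hp.le, ← ENNReal.rpow_mul,
          mul_one_div_cancel hp.ne', ENNReal.rpow_one]

end UnitInterval

theorem inv_sqrt_two_le : (√2)⁻¹ ≤ (4 / 5 : ℝ) := by
  rw [inv_le_comm₀ (by positivity) (by norm_num)]
  exact Real.le_sqrt_of_sq_le (by norm_num)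

/-! ### Chaining over dyadic levels -/

section Chaining

variable {f : ℝ → ℝ} {q : ℝ≥0∞} {K : ℝ}

/-- Telescoping sum of one-level changes. With `ρ = (√2)⁻¹`, the induction closes because `K ρ^{k+1}
≤ 4 K (ρ^k - ρ^{k+1})`, which is where `ρ ≤ 4/5` enters. -/
theorem eLpNorm_comp_dyadicFloor_sub_le (hf : Continuous f) (hq : 1 ≤ q) (hK : 0 ≤ K)
    (hstep : ∀ n, eLpNorm (dyadicStep f n) q volume ≤ ENNReal.ofReal (K * (√2)⁻¹ ^ n)) (n i : ℕ) :
    eLpNorm (fun x => f (dyadicFloor (n + i) x) - f (dyadicFloor n x)) q volume ≤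
      ENNReal.ofReal (4 * K * ((√2)⁻¹ ^ n - (√2)⁻¹ ^ (n + i))) := by
  have hm (n : ℕ) : Measurable fun x => f (dyadicFloor n x) :=
    hf.measurable.comp (measurable_dyadicFloor n)
  have hρ := inv_sqrt_two_le
  have hρ0 : 0 < (√2)⁻¹ := by positivity
  induction i with
  | zero => simp
  | succ i ih =>
    have h1 : eLpNorm (fun x => f (dyadicFloor (n + i + 1) x) - f (dyadicFloor (n + i) x)) q volume
        ≤ ENNReal.ofReal (K * (√2)⁻¹ ^ (n + i + 1)) := by
      refine le_trans ?_ (hstep (n + i + 1))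
      rw [← eLpNorm_comp_measurePreserving (measurable_dyadicStep hf _).aestronglyMeasurable
        (measurePreserving_sub_right volume ((2 : ℝ)⁻¹ ^ (n + i + 1)))]
      exact eLpNorm_mono fun x => abs_comp_dyadicFloor_succ_sub_le f (n + i) x
    have h2 : (fun x => f (dyadicFloor (n + (i + 1)) x) - f (dyadicFloor n x)) =
        (fun x => f (dyadicFloor (n + i + 1) x) - f (dyadicFloor (n + i) x)) +
          fun x => f (dyadicFloor (n + i) x) - f (dyadicFloor n x) := by
      ext x; simp [add_assoc]
    rw [h2]
    refine (eLpNorm_add_le ((hm _).sub (hm _)).aestronglyMeasurable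
      ((hm _).sub (hm _)).aestronglyMeasurable hq).trans ((add_le_add h1 ih).trans ?_)
    have hle : (√2)⁻¹ ^ (n + i) ≤ (√2)⁻¹ ^ n :=
      pow_le_pow_of_le_one hρ0.le (by linarith) (by omega)
    rw [← ENNReal.ofReal_add (by positivity)
      (mul_nonneg (by positivity) (sub_nonneg.2 hle))]
    refine ENNReal.ofReal_le_ofReal ?_
    have h3 : 0 ≤ K * (√2)⁻¹ ^ (n + i) := by positivity
    have h4 : (√2)⁻¹ ^ (n + (i + 1)) = (√2)⁻¹ ^ (n + i) * (√2)⁻¹ := by rw [← add_assoc, pow_succ]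
    rw [h4, ← add_assoc] at *
    rw [pow_succ]
    nlinarith

/-- Fatou's lemma: by continuity the discretizations converge pointwise to `f`, and the previous
bound is uniform in `i`. -/
theorem eLpNorm_sub_comp_dyadicFloor_le (hf : Continuous f) (hq : 1 ≤ q) (hK : 0 ≤ K)
    (hstep : ∀ n, eLpNorm (dyadicStep f n) q volume ≤ ENNReal.ofReal (K * (√2)⁻¹ ^ n)) (n : ℕ) :
    eLpNorm (fun x => f x - f (dyadicFloor n x)) q volume ≤
      ENNReal.ofReal (4 * K * (√2)⁻¹ ^ n) := by
  have hm (n : ℕ) : Measurable fun x => f (dyadicFloor n x) :=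
    hf.measurable.comp (measurable_dyadicFloor n)
  refine (Lp.eLpNorm_lim_le_liminf_eLpNorm
    (f := fun i x => f (dyadicFloor (n + i) x) - f (dyadicFloor n x))
    (fun i => ((hm _).sub (hm _)).aestronglyMeasurable) _ (.of_forall fun x => ?_)).trans ?_
  · refine Filter.Tendsto.sub_const ?_ _
    refine (hf.tendsto x).comp ((tendsto_dyadicFloor x).comp ?_)
    exact Filter.tendsto_atTop_mono (fun i => Nat.le_add_left i n) Filter.tendsto_id
  · refine Filter.liminf_le_of_le (by isBoundedDefault) fun b hb => ?_
    obtain ⟨i, hi⟩ := hb.exists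
    refine hi.trans ((eLpNorm_comp_dyadicFloor_sub_le hf hq hK hstep n i).trans
      (ENNReal.ofReal_le_ofReal ?_))
    gcongr
    have : 0 ≤ (√2)⁻¹ ^ (n + i) := by positivity
    linarith

/-- The constant is `9 = 4 + 4 + 1`: the discretization error at `x + h` and at `x`, plus one dyadic
step. -/
theorem eLpNorm_fwdDiff_le_of_nonneg (hf : Continuous f) (hq : 1 ≤ q) (hK : 0 ≤ K)
    (hstep : ∀ n, eLpNorm (dyadicStep f n) q volume ≤ ENNReal.ofReal (K * (√2)⁻¹ ^ n)) {n : ℕ}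
    {h : ℝ} (h0 : 0 ≤ h) (hn : h ≤ (2 : ℝ)⁻¹ ^ n) :
    eLpNorm (fwdDiff h f) q volume ≤ ENNReal.ofReal (9 * K * (√2)⁻¹ ^ n) := by
  have hm : Measurable fun x => f (dyadicFloor n x) :=
    hf.measurable.comp (measurable_dyadicFloor n)
  set u : ℝ → ℝ := fun x => f x - f (dyadicFloor n x) with hu
  have hum : Measurable u := hf.measurable.sub hm
  have hshift : Measurable fun x : ℝ => x + h := by fun_prop
  have hus : AEStronglyMeasurable (fun x => u (x + h)) volume :=
    (hum.comp hshift).aestronglyMeasurable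
  have hms : AEStronglyMeasurable
      (fun x => f (dyadicFloor n (x + h)) - f (dyadicFloor n x)) volume :=
    ((hm.comp hshift).sub hm).aestronglyMeasurable
  have h1 : fwdDiff h f = (fun x => u (x + h)) - u +
      fun x => f (dyadicFloor n (x + h)) - f (dyadicFloor n x) := by
    ext x; simp only [fwdDiff, hu, Pi.add_apply, Pi.sub_apply]; ring
  have husn : eLpNorm (fun x => u (x + h)) q volume = eLpNorm u q volume :=
    eLpNorm_comp_measurePreserving (g := u) hum.aestronglyMeasurable
      (measurePreserving_add_right volume h)
  have hub := eLpNorm_sub_comp_dyadicFloor_le hf hq hK hstep n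
  rw [h1]
  calc _ ≤ eLpNorm (fun x => u (x + h)) q volume + eLpNorm u q volume +
        eLpNorm (fun x => f (dyadicFloor n (x + h)) - f (dyadicFloor n x)) q volume := by
        refine (eLpNorm_add_le (hus.sub hum.aestronglyMeasurable) hms hq).trans ?_
        gcongr
        exact eLpNorm_sub_le hus hum.aestronglyMeasurable hq
    _ ≤ ENNReal.ofReal (4 * K * (√2)⁻¹ ^ n) + ENNReal.ofReal (4 * K * (√2)⁻¹ ^ n) +
        ENNReal.ofReal (K * (√2)⁻¹ ^ n) := by
        rw [husn]
        gcongr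
        exact (eLpNorm_mono fun x => abs_comp_dyadicFloor_add_sub_le f h0 hn x).trans (hstep n)
    _ = _ := by
        rw [← ENNReal.ofReal_add (by positivity) (by positivity),
          ← ENNReal.ofReal_add (by positivity) (by positivity)]
        ring_nf

theorem eLpNorm_fwdDiff_neg {g : ℝ → ℝ} (hg : Measurable g) (h : ℝ) :
    eLpNorm (fwdDiff (-h) g) q volume = eLpNorm (fwdDiff h g) q volume := by
  have hm : Measurable (fwdDiff h g) := (hg.comp (measurable_id.add_const h)).sub hg
  rw [← eLpNorm_comp_measurePreserving hm.aestronglyMeasurable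
    (measurePreserving_add_right volume (-h)), ← eLpNorm_neg]
  congr 1
  ext x
  simp [fwdDiff]

theorem eLpNorm_fwdDiff_le (hf : Continuous f) (hq : 1 ≤ q) (hK : 0 ≤ K)
    (hstep : ∀ n, eLpNorm (dyadicStep f n) q volume ≤ ENNReal.ofReal (K * (√2)⁻¹ ^ n)) {n : ℕ}
    {h : ℝ} (hn : |h| ≤ (2 : ℝ)⁻¹ ^ n) :
    eLpNorm (fwdDiff h f) q volume ≤ ENNReal.ofReal (9 * K * (√2)⁻¹ ^ n) := by
  rcases abs_cases h with ⟨h1, h2⟩ | ⟨h1, h2⟩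
  · exact eLpNorm_fwdDiff_le_of_nonneg hf hq hK hstep h2 (h1 ▸ hn)
  · rw [← eLpNorm_fwdDiff_neg hf.measurable]
    exact eLpNorm_fwdDiff_le_of_nonneg hf hq hK hstep (by linarith) (h1 ▸ hn)

/-! ### Extension to the line and Besov membership -/

/-- A compactly supported function which agrees with `f - f 0` on `[0, 1]`, if `f` is constant on
each of the two components of the complement of `(0, 1)`. -/
noncomputable def reflectExtension (f : ℝ → ℝ) (x : ℝ) : ℝ := f x + f (2 - x) - f 1 - f 0

theorem eLpNorm_fwdDiff_reflectExtension_le (hf : Continuous f) (hq : 1 ≤ q) (h : ℝ) :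
    eLpNorm (fwdDiff h (reflectExtension f)) q volume ≤ 2 * eLpNorm (fwdDiff h f) q volume := by
  have hm (h : ℝ) : Measurable (fwdDiff h f) :=
    (hf.measurable.comp (measurable_id.add_const h)).sub hf.measurable
  have h2 : Measurable fun x : ℝ => 2 - x := by fun_prop
  have h1 : fwdDiff h (reflectExtension f) = fwdDiff h f + fun x => fwdDiff (-h) f (2 - x) := by
    ext x
    simp only [fwdDiff, reflectExtension, Pi.add_apply, show 2 - (x + h) = 2 - x + -h by ring]
    ring
  have h3 : eLpNorm (fun x => fwdDiff (-h) f (2 - x)) q volume = eLpNorm (fwdDiff h f) q volume := by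
    rw [← eLpNorm_fwdDiff_neg hf.measurable]
    exact eLpNorm_comp_measurePreserving (g := fwdDiff (-h) f) (hm _).aestronglyMeasurable
      (Measure.measurePreserving_sub_left volume 2)
  rw [h1, two_mul]
  have h4 : AEStronglyMeasurable (fun x => fwdDiff (-h) f (2 - x)) volume :=
    ((hm _).comp h2).aestronglyMeasurable
  refine (eLpNorm_add_le (hm h).aestronglyMeasurable h4 hq).trans ?_
  rw [h3]

theorem hasCompactSupport_reflectExtension (h0 : ∀ x ≤ 0, f x = f 0)
    (h1 : ∀ x, 1 ≤ x → f x = f 1) : HasCompactSupport (reflectExtension f) := by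
  refine HasCompactSupport.intro (isCompact_Icc (a := (0 : ℝ)) (b := 2)) fun x hx => ?_
  rw [reflectExtension]
  rcases lt_or_ge x 0 with hx0 | hx0
  · rw [h0 x hx0.le, h1 (2 - x) (by linarith)]; ring
  · have hx2 : 2 < x := by by_contra! hc; exact hx ⟨hx0, hc⟩
    rw [h1 x (by linarith), h0 (2 - x) (by linarith)]; ring

theorem reflectExtension_mem_spaceReal (hf : Continuous f) (h0 : ∀ x ≤ 0, f x = f 0)
    (h1 : ∀ x, 1 ≤ x → f x = f 1) (hq : 1 ≤ q) (hK : 0 ≤ K)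
    (hstep : ∀ n, eLpNorm (dyadicStep f n) q volume ≤ ENNReal.ofReal (K * (√2)⁻¹ ^ n)) :
    reflectExtension f ∈ Besov.spaceReal ℝ (1 / 2) q ∞ := by
  have hcont : Continuous (reflectExtension f) := by unfold reflectExtension; fun_prop
  have hL : MemLp (reflectExtension f) q volume :=
    hcont.memLp_of_hasCompactSupport (hasCompactSupport_reflectExtension h0 h1)
  refine ⟨hL, ENNReal.add_lt_top.2 ⟨hL.eLpNorm_lt_top, ?_⟩⟩
  have hfl : ⌊(1 / 2 : ℝ)⌋₊ + 1 = 1 := by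
    rw [Nat.floor_eq_zero.2 (by norm_num)]
  rw [Besov.eSeminorm, if_pos rfl, hfl]
  refine lt_of_le_of_lt (b := ENNReal.ofReal (√2 * (18 * K))) ?_ ENNReal.ofReal_lt_top
  refine iSup₂_le fun t ht => ?_
  -- Choose `n` with `2^{-n-1} < t ≤ 2^{-n}`; the mismatch between `t` and `2⁻ⁿ` costs the factor
  -- `√2`.
  obtain ⟨n, hn1, hn2⟩ := exists_nat_pow_near_of_lt_one ht.1 ht.2
    (by norm_num : (0 : ℝ) < 2⁻¹) (by norm_num)
  have hmod : Besov.modulus 1 q (reflectExtension f) t ≤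
      ENNReal.ofReal (18 * K * (√2)⁻¹ ^ n) := by
    refine iSup₂_le fun h hh => ?_
    rw [Function.iterate_one]
    refine (eLpNorm_fwdDiff_reflectExtension_le hf hq h).trans ?_
    calc 2 * eLpNorm (fwdDiff h f) q volume
        ≤ ENNReal.ofReal 2 * ENNReal.ofReal (9 * K * (√2)⁻¹ ^ n) := by
          rw [ENNReal.ofReal_ofNat]
          gcongr
          exact eLpNorm_fwdDiff_le hf hq hK hstep (hh.trans hn2)
      _ = _ := by rw [← ENNReal.ofReal_mul (by norm_num)]; ring_nf
  have hroot : (√2)⁻¹ ^ (n + 1) ≤ √t := by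
    rw [← Real.sqrt_inv]
    refine Real.le_sqrt_of_sq_le ?_
    rw [← pow_mul, mul_comm, pow_mul, Real.sq_sqrt (by norm_num)]
    exact hn1.le
  have ht0 : 0 < √t := Real.sqrt_pos.2 ht.1
  calc ENNReal.ofReal (t ^ (-(1 / 2 : ℝ))) * Besov.modulus 1 q (reflectExtension f) t
      ≤ ENNReal.ofReal (t ^ (-(1 / 2 : ℝ))) * ENNReal.ofReal (18 * K * (√2)⁻¹ ^ n) := by gcongr
    _ = ENNReal.ofReal ((√t)⁻¹ * (18 * K * (√2)⁻¹ ^ n)) := by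
        rw [← ENNReal.ofReal_mul (by have := ht.1; positivity), Real.rpow_neg ht.1.le,
          ← Real.sqrt_eq_rpow]
    _ ≤ _ := by
        refine ENNReal.ofReal_le_ofReal ?_
        rw [inv_mul_le_iff₀ ht0]
        have h3 : (√2)⁻¹ ^ n = √2 * (√2)⁻¹ ^ (n + 1) := by
          rw [pow_succ]; field_simp
        rw [h3]
        calc 18 * K * (√2 * (√2)⁻¹ ^ (n + 1)) = √2 * (18 * K) * (√2)⁻¹ ^ (n + 1) := by ring
          _ ≤ √2 * (18 * K) * √t := by gcongr
          _ = _ := mul_comm _ _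

end Chaining

/-- A continuous function that vanishes on `(-∞, 0]` and has dyadic increments on
`[0, 1]` of the size of those of Brownian motion in the `p`-mean belongs to
`B^{1/2}_{p,∞}([0,1])`. -/
theorem mem_spaceUnitInterval_of_average_dyadicIncr {p : ℝ} (hp : 1 ≤ p) {w : ℝ → ℝ}
    (hw : Continuous w) (hw0 : ∀ x ≤ 0, w x = 0)
    (hbdd : BddAbove (range fun j : ℕ => (2 : ℝ)⁻¹ ^ j *
      ∑ m : Fin (2 ^ j), |(2 : ℝ) ^ ((j : ℝ) / 2) * dyadicIncr w j m| ^ p)) :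
    w ∈ Besov.spaceUnitInterval ℝ (1 / 2) (ENNReal.ofReal p) ∞ := by
  obtain ⟨C, hC⟩ := hbdd
  have hp0 : 0 < p := by linarith
  -- Freezing the path at time `1` makes `f` constant on `[1, ∞)` without changing its dyadic
  -- increments in `[0, 1]`.
  set f : ℝ → ℝ := fun x => w (min x 1) with hf
  have hfw (x : ℝ) (hx : x ≤ 1) : f x = w x := by simp [hf, hx]
  have hfc : Continuous f := by fun_prop
  have h0 (x : ℝ) (hx : x ≤ 0) : f x = f 0 := by
    rw [hfw x (by linarith), hfw 0 (by norm_num), hw0 x hx, hw0 0 le_rfl]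
  have h1 (x : ℝ) (hx : 1 ≤ x) : f x = f 1 := by simp [hf, hx]
  have hincr (n : ℕ) (m : Fin (2 ^ n)) : dyadicIncr f n m = dyadicIncr w n m := by
    have h2 : ((m : ℝ) + 1) * (2 : ℝ)⁻¹ ^ n ≤ 1 := by
      have h3 : ((m : ℝ) + 1) ≤ 2 ^ n := by exact_mod_cast m.2
      calc ((m : ℝ) + 1) * (2 : ℝ)⁻¹ ^ n ≤ 2 ^ n * (2 : ℝ)⁻¹ ^ n := by gcongr
        _ = 1 := by rw [← mul_pow]; norm_num
    have h3 : (m : ℝ) * (2 : ℝ)⁻¹ ^ n ≤ 1 := le_trans (by gcongr; linarith) h2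
    rw [dyadicIncr, dyadicIncr, hfw _ h2, hfw _ h3]
  have hCn (n : ℕ) : (2 : ℝ)⁻¹ ^ n *
      ∑ m : Fin (2 ^ n), |(2 : ℝ) ^ ((n : ℝ) / 2) * dyadicIncr f n m| ^ p ≤ C := by
    simp only [hincr]
    exact hC ⟨n, rfl⟩
  have hC0 : 0 ≤ C := le_trans (by positivity) (hCn 0)
  have hmem : reflectExtension f ∈ Besov.spaceReal ℝ (1 / 2) (ENNReal.ofReal p) ∞ :=
    reflectExtension_mem_spaceReal hfc h0 h1 (by simpa using hp) (Real.rpow_nonneg hC0 _)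
      fun n => eLpNorm_dyadicStep_le h0 h1 hp0 (hCn n)
  have heq : reflectExtension f =ᵐ[volume.restrict (Icc (0 : ℝ) 1)] w := by
    filter_upwards [ae_restrict_mem measurableSet_Icc] with x hx
    rw [reflectExtension, h1 (2 - x) (by linarith [hx.2]), hfw x hx.2, hfw 0 (by norm_num),
      hw0 0 le_rfl]
    ring
  exact ⟨(memLp_congr_ae heq).1 (hmem.1.restrict _), _, hmem, heq⟩

theorem mainTheorem9 {Ω : Type*} [MeasurableSpace Ω] (P : Measure Ω) [IsProbabilityMeasure P]
    (p : ℝ) (hp : 1 ≤ p) :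
    -- independent standard Gaussian variables
    (∀ ξ : (j : ℕ) → Fin (2 ^ j) → Ω → ℝ,
      (∀ j m, HasLaw (ξ j m) (gaussianReal 0 1) P) →
      iIndepFun (fun i : (j : ℕ) × Fin (2 ^ j) => ξ i.1 i.2) P →
      ∀ᵐ ω ∂P, BddAbove (range fun j : ℕ =>
        (2 : ℝ)⁻¹ ^ j * ∑ m : Fin (2 ^ j), |ξ j m ω| ^ p)) ∧
    -- Brownian motion: its coefficients in the Faber expansion, and its paths
    (∀ W : ℝ≥0 → Ω → ℝ, IsBrownianReal W P →
      (∀ᵐ ω ∂P, BddAbove (range fun j : ℕ =>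
        (2 : ℝ)⁻¹ ^ j * ∑ m : Fin (2 ^ j), |faberCoeff (samplePath W ω) j m| ^ p)) ∧
      (∀ᵐ ω ∂P,
        samplePath W ω ∈ Besov.spaceUnitInterval ℝ (1 / 2) (ENNReal.ofReal p) ∞)) := by
  have hp0 : 0 < p := by linarith
  refine ⟨fun ξ hlaw hind => ae_bddAbove_average_abs_rpow P hp0 ξ hlaw fun j m m' hm =>
    hind.indepFun (i := ⟨j, m⟩) (j := ⟨j, m'⟩) (by simpa using hm), fun W hW => ⟨?_, ?_⟩⟩
  · filter_upwards [ae_bddAbove_average_dyadicIncr P hp0 hW.toIsPreBrownianReal] with ω hω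
    exact bddAbove_average_faberCoeff hp _ hω
  · filter_upwards [ae_bddAbove_average_dyadicIncr P hp0 hW.toIsPreBrownianReal, hW.cont,
      hW.eval_zero_ae_eq_zero] with ω hω hcont hzero
    refine mem_spaceUnitInterval_of_average_dyadicIncr hp (hcont.comp continuous_real_toNNReal)
      (fun x hx => ?_) hω
    -- Truncation by `toNNReal` extends the path to negative times by `W 0`, which is almost surely
    -- zero.
    rw [samplePath, Real.toNNReal_of_nonpos hx, hzero]
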